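/- Let $N=\{1,\dots,n\}$ be a set of $n\ge 3$ countries. A network of alliances $g$ is a set of unordered pairs of distinct countries; write $N_i(g)=\{j: ij\in g\}$, and write $g+jk$ and $g-jk$ for $g$ with the alliance $jk$ added or deleted. Given military strengths $M_1,\dots,M_n$ and a constant $\gamma$ (the defensive advantage), a country $i$ is \emph{CN-vulnerable} at $g$ if there is a nonempty clique $C$ of $g$ (every two distinct members are allied; single countries count as cliques) with $i\notin C$ such that $$\sum_{k\in C}M_k>\gamma\sum_{k\in C'}M_k,\qquad C'=\{i\}\cup(N_i(g)\setminus C).$$ The network $g$ is \emph{CN-war-stable} if (S1) no country is CN-vulnerable at $g$; (S2) for all distinct $j,k$ with $jk\notin g$, no country is CN-vulnerable at $g+jk$; and (S3) for every $jk\in g$, both $j$ and $k$ are CN-vulnerable at $g-jk$. **Theorem.** Let $n\ge 3$, let $\overline M>0$, and let $\gamma$ be a real number with the no-tie property relative to $n$: there are no positive integers $m_1,m_2$ with $m_1+m_2\le n$ and $m_1=\gamma m_2$. Then there is an open set $\mathcal M\subset(0,\infty)$ with $\overline M\in\mathcal M$ such that the following hold. 1. If $1\le\gamma<2$ and $(M_1,\dots,M_n)\in\mathcal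 M^n$, then there are no CN-war-stable networks. 2. If $\gamma\ge 2$ and $(M_1,\dots,M_n)\in\mathcal M^n$, then the empty network is CN-war-stable, and it is the only CN-war-stable network. -/

import Mathlib

namespace WarNetwork

/-- A coalition `C` is a finite set of countries. Strengths `M` and the defensive/offensive
advantage `γ` are given on coalitions, `γ C C'` being the parameter when `C` attacks `C'`.
`Wins M γ C C'` says that the aggressor `C` wins a war against `C'`. -/
def Wins {V : Type*} (M : Finset V → ℝ) (γ : Finset V → Finset V → ℝ) (C C' : Finset V) : Prop :=
  M C > γ C C' * M C'

open Classical in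
/-- The coalition defending `i` against the attackers `C` at the network `g`: the country `i`
together with all its allies outside `C`. -/
noncomputable def defenders {V : Type*} [Fintype V] (g : SimpleGraph V) (i : V) (C : Finset V) :
    Finset V :=
  insert i (Finset.univ.filter fun k => g.Adj i k ∧ k ∉ C)

/-- Country `i` is CN-vulnerable at `g`: some country `j` and some clique `C` of `g` that contains
`j` but not `i` defeat `i` and its remaining allies. -/
def CNVulnerable {V : Type*} [Fintype V] (M : Finset V → ℝ) (γ : Finset V → Finset V → ℝ)
    (g : SimpleGraph V) (i : V) : Prop :=
  ∃ (j : V) (C : Finset V), j ∈ C ∧ i ∉ C ∧ g.IsClique (C : Set V) ∧ Wins M γ C (defenders g i C)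

/-- The network `g + jk`. -/
def addAlliance {V : Type*} (g : SimpleGraph V) (j k : V) : SimpleGraph V :=
  g ⊔ SimpleGraph.edge j k

/-- The network `g - jk`. -/
def removeAlliance {V : Type*} (g : SimpleGraph V) (j k : V) : SimpleGraph V :=
  g.deleteEdges {s(j, k)}

/-- CN-war-stability of an alliance network. -/
structure CNWarStable {V : Type*} [Fintype V] (M : Finset V → ℝ) (γ : Finset V → Finset V → ℝ)
    (g : SimpleGraph V) : Prop where
  /-- No country is vulnerable. -/
  not_vulnerable : ∀ i, ¬ CNVulnerable M γ g i
  /-- No country becomes vulnerable when an alliance is added. -/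
  add_alliance : ∀ j k, j ≠ k → ¬ g.Adj j k → ∀ i, ¬ CNVulnerable M γ (addAlliance g j k) i
  /-- Deleting an alliance makes both of its members vulnerable. -/
  remove_alliance : ∀ j k, g.Adj j k →
    CNVulnerable M γ (removeAlliance g j k) j ∧ CNVulnerable M γ (removeAlliance g j k) k

/-- The collective strength of a coalition is the sum of the strengths of its members. -/
def additiveStrength {V : Type*} (m : V → ℝ) (C : Finset V) : ℝ := ∑ i ∈ C, m i

/-- The no-tie property of `γ` relative to `n`. -/
def NoTie (γ : ℝ) (n : ℕ) : Prop :=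
  ¬ ∃ m₁ m₂ : ℕ, 0 < m₁ ∧ 0 < m₂ ∧ m₁ + m₂ ≤ n ∧ (m₁ : ℝ) = γ * (m₂ : ℝ)

end WarNetwork

/-! Without ties, strengths close enough to `Mbar` leave every war decided by the coalition sizes,
so only sizes matter (`NoTie.exists_pos`, `CNWarStable.congr`).

Suppose a nonempty network is stable, and let `i` have maximum degree `d`. For each ally `j`, losing
`ij` exposes `i` to a clique `X j` that avoids `j` and has more than `γ` times as many members as
`i` has allies outside it. Maximality of `d` puts `X j` inside the neighbourhood of `i`
(`subset_allies`), and (S1) makes it a maximum clique there, of size `w`. The `X j` have no common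
member, so Hajnal's lemma gives `2 * w ≤ d`; but `w > γ * (d - w) ≥ d - w`, a contradiction.

For the empty network, the only new threat after one addition is a pair against a lone country,
which wins exactly when `γ < 2`. -/

namespace WarNetwork

open Finset Classical

/-! ### Hajnal's lemma on collections of maximum cliques -/

/-- Hajnal: the intersection and the union of a nonempty family of maximum cliques (among those
contained in `A`) have total size at least twice the clique number. -/
theorem two_mul_card_le_card_inter_add_card_union {V ι : Type*} (g : SimpleGraph V) (A : Finset V)
    (w : ℕ) (hw : ∀ C : Finset V, C ⊆ A → g.IsClique (C : Set V) → C.card ≤ w)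
    (X : ι → Finset V) {J : Finset ι} (hJ : J.Nonempty)
    (hX : ∀ j ∈ J, X j ⊆ A ∧ g.IsClique (X j : Set V) ∧ (X j).card = w) :
    2 * w ≤ (A.filter fun v => ∀ j ∈ J, v ∈ X j).card + (J.biUnion X).card := by
  induction hJ using Finset.Nonempty.cons_induction with
  | singleton a =>
    obtain ⟨hA, -, hc⟩ := hX a (by simp)
    have : (A.filter fun v => ∀ j ∈ ({a} : Finset ι), v ∈ X j) = X a := by
      ext v
      simpa using fun h => hA h
    rw [this, singleton_biUnion, hc]
    omega
  | cons a s ha hs ih =>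
    specialize ih fun j hj => hX j (mem_cons_of_mem hj)
    obtain ⟨hA, hcl, hc⟩ := hX a (mem_cons_self a s)
    set I := A.filter fun v => ∀ j ∈ s, v ∈ X j with hI
    set U := s.biUnion X with hU
    have hI' : (A.filter fun v => ∀ j ∈ cons a s ha, v ∈ X j) = I ∩ X a := by
      ext v
      simp only [hI, mem_filter, mem_inter, forall_mem_cons]
      tauto
    have hU' : (cons a s ha).biUnion X = X a ∪ U := by
      rw [cons_eq_insert, biUnion_insert]
    have hIU : ∀ u ∈ I, ∀ v ∈ U, u ≠ v → g.Adj u v := by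
      intro u hu v hv huv
      obtain ⟨j, hj, hvj⟩ := mem_biUnion.1 hv
      exact (hX j (mem_cons_of_mem hj)).2.1 ((mem_filter.1 hu).2 j hj) hvj huv
    have hIsub : I ⊆ U := by
      obtain ⟨j, hj⟩ := hs
      exact fun v hv => mem_biUnion.2 ⟨j, hj, (mem_filter.1 hv).2 j hj⟩
    -- Members of `I` are joined to all of `U`, so this set is a clique. Its bound `w` and two
    -- inclusion-exclusions show that adding `X a` does not decrease the total.
    have hclique : g.IsClique ((I ∪ X a ∩ U : Finset V) : Set V) := by
      intro u hu v hv huv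
      simp only [coe_union, coe_inter, Set.mem_union, Set.mem_inter_iff, mem_coe] at hu hv
      rcases hu with hu | ⟨hu, hu'⟩
      · exact hIU u hu v (hv.elim (fun h => hIsub h) And.right) huv
      · rcases hv with hv | ⟨hv, hv'⟩
        · exact (hIU v hv u hu' huv.symm).symm
        · exact hcl hu hv huv
    have hle := hw (I ∪ X a ∩ U)
      (union_subset (filter_subset _ _) (inter_subset_left.trans hA)) hclique
    have h1 := card_union_add_card_inter I (X a ∩ U)
    have h2 : I ∩ (X a ∩ U) = I ∩ X a := by
      ext v
      simp only [mem_inter]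
      exact ⟨fun h => ⟨h.1, h.2.1⟩, fun h => ⟨h.1, h.2, hIsub h.1⟩⟩
    have h3 := card_union_add_card_inter (X a) U
    rw [h2] at h1
    rw [hI', hU']
    omega

/-! ### Allies, defenders and size as strength -/

variable {V : Type*} [Fintype V]

/-- The set of allies of `i`. -/
noncomputable def allies (g : SimpleGraph V) (i : V) : Finset V :=
  univ.filter fun k => g.Adj i k

theorem mem_allies {g : SimpleGraph V} {i k : V} : k ∈ allies g i ↔ g.Adj i k := by
  simp [allies]

theorem defenders_eq (g : SimpleGraph V) (i : V) (C : Finset V) :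
    defenders g i C = insert i (allies g i \ C) := by
  ext k
  simp [defenders, allies]

theorem card_defenders (g : SimpleGraph V) (i : V) (C : Finset V) :
    (defenders g i C).card = 1 + (allies g i \ C).card := by
  rw [defenders_eq, card_insert_of_notMem (by simp [mem_allies]), add_comm]

/-- The strength of a coalition whose members all have strength one. -/
def cardStrength {V : Type*} (C : Finset V) : ℝ := C.card

/-! ### Stability for coalitions measured by their size -/

section Stable

variable {γ : ℝ} {g : SimpleGraph V}

theorem CNWarStable.card_le_of_isClique (h : CNWarStable cardStrength (fun _ _ => γ) g)
    (hγ : 0 ≤ γ) {C : Finset V} (hC : g.IsClique (C : Set V)) {i : V} (hi : i ∉ C) :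
    (C.card : ℝ) ≤ γ * (1 + (allies g i \ C).card) := by
  rcases C.eq_empty_or_nonempty with rfl | ⟨j, hj⟩
  · simp only [card_empty, CharP.cast_eq_zero]
    positivity
  · by_contra! hlt
    refine h.not_vulnerable i ⟨j, C, hj, hi, hC, ?_⟩
    simp only [Wins, cardStrength, card_defenders]
    push_cast
    exact hlt

/-- Combines (S1) and (S2): a clique lacking at most the link `ab` is still harmless. Adding `ab`
leaves the allies of `i` unchanged, because both endpoints lie in `C`. -/
theorem CNWarStable.card_le_of_isClique_add (h : CNWarStable cardStrength (fun _ _ => γ) g)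
    (hγ : 0 ≤ γ) {C : Finset V} {a b : V} (ha : a ∈ C) (hb : b ∈ C) (hab : a ≠ b)
    (hC : ∀ u ∈ C, ∀ v ∈ C, u ≠ v → g.Adj u v ∨ s(u, v) = s(a, b)) {i : V} (hi : i ∉ C) :
    (C.card : ℝ) ≤ γ * (1 + (allies g i \ C).card) := by
  by_cases hadj : g.Adj a b
  · refine h.card_le_of_isClique hγ (fun u hu v hv huv => ?_) hi
    rcases hC u hu v hv huv with h1 | h1
    · exact h1
    · exact (SimpleGraph.adj_congr_of_sym2 g h1).2 hadj
  · by_contra! hlt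
    refine h.add_alliance a b hab hadj i ⟨a, C, ha, hi, fun u hu v hv huv => ?_, ?_⟩
    · rcases hC u hu v hv huv with h1 | h1
      · exact Or.inl h1
      · exact Or.inr ((SimpleGraph.edge_adj ..).2 ⟨by simpa using h1, huv⟩)
    · have : allies (addAlliance g a b) i = allies g i := by
        ext v
        have : ¬ (SimpleGraph.edge a b).Adj i v := by
          rw [SimpleGraph.edge_adj]
          rintro ⟨⟨rfl, rfl⟩ | ⟨rfl, rfl⟩, -⟩
          · exact hi ha
          · exact hi hb
        simp [mem_allies, addAlliance, this]
      simp only [Wins, cardStrength, card_defenders, this]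
      push_cast
      exact hlt

theorem CNWarStable.exists_isClique_of_adj (h : CNWarStable cardStrength (fun _ _ => γ) g)
    (hγ : 0 ≤ γ) {i j : V} (hij : g.Adj i j) :
    ∃ C : Finset V, g.IsClique (C : Set V) ∧ i ∉ C ∧ j ∉ C ∧
      γ * (allies g i \ C).card < C.card := by
  obtain ⟨k, C, -, hi, hC, hlt⟩ := (h.remove_alliance i j hij).1
  have hC' : g.IsClique (C : Set V) := hC.mono (SimpleGraph.deleteEdges_le _)
  have hN : allies (removeAlliance g i j) i = (allies g i).erase j := by
    ext v
    simp only [mem_allies, removeAlliance, SimpleGraph.deleteEdges_adj, Set.mem_singleton_iff,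
      mem_erase]
    constructor
    · rintro ⟨h1, h2⟩
      exact ⟨fun h => h2 (by rw [h]), h1⟩
    · rintro ⟨h1, h2⟩
      refine ⟨h2, fun h => h1 ?_⟩
      simpa [hij.ne] using h
  simp only [Wins, cardStrength, card_defenders, hN] at hlt
  push_cast at hlt
  -- If `j` were an attacker, it would not defend `i` even with `ij` present, so `i` would already
  -- be vulnerable at `g`.
  have hj : j ∉ C := by
    intro hj
    have : (allies g i).erase j \ C = allies g i \ C := by
      ext v
      simp only [mem_sdiff, mem_erase]
      exact ⟨fun h => ⟨h.1.2, h.2⟩, fun h => ⟨⟨fun e => h.2 (e ▸ hj), h.1⟩, h.2⟩⟩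
    rw [this] at hlt
    exact absurd (h.card_le_of_isClique hγ hC' hi) (not_le.2 hlt)
  refine ⟨C, hC', hi, hj, ?_⟩
  have : (allies g i \ C).card = 1 + ((allies g i).erase j \ C).card := by
    rw [erase_sdiff_comm, add_comm, card_erase_add_one]
    simp [mem_allies, hij, hj]
  rw [this]
  push_cast
  exact hlt

/-- A coalition that makes a country of largest degree vulnerable after the loss of an ally
consists of allies of that country. -/
theorem CNWarStable.subset_allies (h : CNWarStable cardStrength (fun _ _ => γ) g)
    (hγ : 1 ≤ γ) {i j : V} (hmax : ∀ k, (allies g k).card ≤ (allies g i).card)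
    (hij : g.Adj i j) {C : Finset V} (hC : g.IsClique (C : Set V)) (hi : i ∉ C) (hj : j ∉ C)
    (hlt : γ * (allies g i \ C).card < C.card) : C ⊆ allies g i := by
  have hγ0 : 0 ≤ γ := by linarith
  by_contra hsub
  obtain ⟨p, hp, hpi⟩ := not_subset.1 hsub
  have hsplit := card_sdiff_add_card_inter (allies g i) C
  have hsplit' := card_sdiff_add_card_inter C (allies g i)
  rw [inter_comm] at hsplit'
  have hz : 0 < (allies g i \ C).card :=
    card_pos.2 ⟨j, by simp [mem_allies, hij, hj]⟩
  have hy : 0 < (C \ allies g i).card := card_pos.2 ⟨p, by simp [hp, hpi]⟩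
  have hdeg : ∀ k (D E : Finset V), E ⊆ D → E ⊆ allies g k →
      (allies g k \ D).card + E.card ≤ (allies g i).card := by
    intro k D E h1 h2
    have := card_sdiff_add_card_inter (allies g k) D
    have := card_le_card (subset_inter h2 h1)
    have := hmax k
    omega
  have hsubal : ∀ k ∈ C, C.erase k ⊆ allies g k := fun k hk v hv =>
    mem_allies.2 (hC hk (mem_of_mem_erase hv) (ne_of_mem_erase hv).symm)
  have hcard : ∀ k ∈ C, (C.erase k).card + 1 = C.card := fun k hk => card_erase_add_one hk
  have hcardi : ∀ k ∈ C, (insert i (C.erase k)).card = C.card := fun k hk => by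
    rw [card_insert_of_notMem fun h => hi (mem_of_mem_erase h), hcard k hk]
  -- Exchange argument: `i` replaces `k` among the attackers, at most the link `iq` is missing, and
  -- `k` becomes the target.
  have hnear : ∀ k ∈ C, ∀ q ∈ C.erase k, (∀ v ∈ C.erase k, v ≠ q → g.Adj i v) →
      (C.card : ℝ) ≤ γ * (1 + (allies g k \ insert i (C.erase k)).card) := by
    intro k hk q hq hall
    have hiq : i ≠ q := fun e => hi (e ▸ mem_of_mem_erase hq)
    rw [← hcardi k hk]
    refine h.card_le_of_isClique_add hγ0 (mem_insert_self i _) (mem_insert_of_mem hq) hiq ?_ ?_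
    · intro u hu v hv huv
      rcases mem_insert.1 hu with rfl | hu' <;> rcases mem_insert.1 hv with rfl | hv'
      · exact absurd rfl huv
      · by_cases hvq : v = q
        · exact Or.inr (by rw [hvq])
        · exact Or.inl (hall v hv' hvq)
      · by_cases huq : u = q
        · exact Or.inr (by rw [huq, Sym2.eq_swap])
        · exact Or.inl (hall u hu' huq).symm
      · exact Or.inl (hC (mem_of_mem_erase hu') (mem_of_mem_erase hv') huv)
    · rw [mem_insert, not_or]
      exact ⟨fun e => hi (e ▸ hk), notMem_erase k C⟩
  have hgam : ∀ w t : ℕ, w ≤ t → γ * w ≤ γ * t := fun w t hwt =>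
    mul_le_mul_of_nonneg_left (by exact_mod_cast hwt) hγ0
  rcases Nat.lt_or_ge 2 (C \ allies g i).card with h3 | h3
  -- At least three non-allies: the rest of `C` attacks `p`, whose degree bound leaves it at least
  -- two fewer outside allies than `i`. The lost attacker is offset by `γ ≥ 1`.
  · have h1 := h.card_le_of_isClique hγ0 (hC.subset (by simp))
      (notMem_erase p C)
    have h2 := hdeg p (C.erase p) (C.erase p) Subset.rfl (hsubal p hp)
    have h4 := hcard p hp
    have h5 := hgam ((allies g p \ C.erase p).card + 2) (allies g i \ C).card (by omega)
    have h6 : ((C.erase p).card : ℝ) + 1 = C.card := by exact_mod_cast h4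
    push_cast at h5
    nlinarith
  · obtain h2 | h1 : (C \ allies g i).card = 2 ∨ (C \ allies g i).card = 1 := by omega
    -- Two non-allies `p`, `q`: `i` replaces `p`, only `iq` is missing, and `p` is attacked.
    · obtain ⟨q, hq⟩ : ∃ q, (C \ allies g i).erase p = {q} := by
        rw [← card_eq_one, card_erase_of_mem (by simp [hp, hpi]), h2]
      have hqmem : q ∈ (C \ allies g i).erase p := by simp [hq]
      simp only [mem_erase, mem_sdiff] at hqmem
      have h1 := hnear p hp q (mem_erase.2 ⟨hqmem.1, hqmem.2.1⟩) fun v hv hvq => by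
        by_contra hadj
        have : v ∈ (C \ allies g i).erase p := by
          simp only [mem_erase, mem_sdiff, mem_allies] at hv ⊢
          exact ⟨hv.1, hv.2, hadj⟩
        rw [hq, mem_singleton] at this
        exact hvq this
      have h4 := hdeg p (insert i (C.erase p)) (C.erase p) (subset_insert _ _) (hsubal p hp)
      have h5 := hcard p hp
      have h6 := hgam ((allies g p \ insert i (C.erase p)).card + 1) (allies g i \ C).card
        (by omega)
      push_cast at h6
      linarith
    -- One non-ally `p`: the target is an ally `k` of `i` in `C`. Since `k` is also linked to `i`,
    -- its degree bound gains the one needed.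
    · obtain ⟨q, hq⟩ := card_eq_one.1 h1
      have hpq : p ∈ C \ allies g i := by simp [hp, hpi]
      rw [hq, mem_singleton] at hpq
      subst hpq
      have hC1 : 1 < C.card := by
        have h4 : (1 : ℝ) ≤ (allies g i \ C).card := by exact_mod_cast hz
        have h5 : (1 : ℝ) < C.card := by nlinarith
        exact_mod_cast h5
      obtain ⟨k, hk⟩ : (allies g i ∩ C).Nonempty := card_pos.1 (by omega)
      obtain ⟨hki, hkC⟩ := mem_inter.1 hk
      have hpk : p ≠ k := fun e => hpi (e ▸ hki)
      have h2 := hnear k hkC p (mem_erase.2 ⟨hpk, hp⟩) fun v hv hvp => by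
        by_contra hadj
        have : v ∈ C \ allies g i := mem_sdiff.2 ⟨mem_of_mem_erase hv, by rwa [mem_allies]⟩
        rw [hq, mem_singleton] at this
        exact hvp this
      have h4 := hdeg k (insert i (C.erase k)) (insert i (C.erase k)) Subset.rfl
        (insert_subset (mem_allies.2 (mem_allies.1 hki).symm) (hsubal k hkC))
      have h5 := hcardi k hkC
      have h6 := hgam ((allies g k \ insert i (C.erase k)).card + 1) (allies g i \ C).card
        (by omega)
      push_cast at h6
      linarith

/-- No nonempty network is stable when coalitions are measured by their size. -/
theorem CNWarStable.eq_bot (h : CNWarStable cardStrength (fun _ _ => γ) g) (hγ : 1 ≤ γ) :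
    g = ⊥ := by
  have hγ0 : 0 ≤ γ := by linarith
  by_contra hg
  obtain ⟨a, b, hab⟩ := SimpleGraph.ne_bot_iff_exists_adj.1 hg
  obtain ⟨i, -, hi⟩ := exists_max_image univ (fun k => (allies g k).card) ⟨a, mem_univ a⟩
  have hmax : ∀ k, (allies g k).card ≤ (allies g i).card := fun k => hi k (mem_univ k)
  have hpos : 0 < (allies g i).card :=
    (card_pos.2 ⟨b, mem_allies.2 hab⟩).trans_le (hmax a)
  have hex : ∀ j ∈ allies g i, ∃ C : Finset V, C ⊆ allies g i ∧ g.IsClique (C : Set V) ∧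
      j ∉ C ∧ γ * (allies g i \ C).card < C.card := by
    intro j hj
    obtain ⟨C, hC, hiC, hjC, hlt⟩ := h.exists_isClique_of_adj hγ0 (mem_allies.1 hj)
    exact ⟨C, h.subset_allies hγ hmax (mem_allies.1 hj) hC hiC hjC hlt, hC, hjC, hlt⟩
  choose! X hXsub hXcl hXj hXlt using hex
  have hsd : ∀ C, C ⊆ allies g i → ((allies g i \ C).card : ℝ) + C.card = (allies g i).card :=
    fun C hC => by exact_mod_cast card_sdiff_add_card_eq_card hC
  obtain ⟨j₀, hj₀⟩ := card_pos.1 hpos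
  have hle : ∀ C : Finset V, C ⊆ allies g i → g.IsClique (C : Set V) →
      ∀ j ∈ allies g i, C.card ≤ (X j).card := by
    intro C hCs hC j hj
    -- A larger clique leaves `i` at least one ally fewer outside it, which cancels the `1` that
    -- counts `i` itself in the (S1) bound.
    by_contra! hlt
    have h1 := h.card_le_of_isClique hγ0 hC (i := i) fun hmem =>
      g.irrefl (mem_allies.1 (hCs hmem))
    have h2 := hXlt j hj
    have h3 := hsd C hCs
    have h4 := hsd (X j) (hXsub j hj)
    have h5 : ((X j).card : ℝ) + 1 ≤ C.card := by exact_mod_cast hlt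
    nlinarith
  have key := two_mul_card_le_card_inter_add_card_union g (allies g i) (X j₀).card
    (fun C hCs hC => hle C hCs hC j₀ hj₀) X ⟨j₀, hj₀⟩ fun j hj =>
      ⟨hXsub j hj, hXcl j hj, le_antisymm (hle _ (hXsub j hj) (hXcl j hj) j₀ hj₀)
        (hle _ (hXsub j₀ hj₀) (hXcl j₀ hj₀) j hj)⟩
  have hunion : ((allies g i).biUnion X).card ≤ (allies g i).card :=
    card_le_card (biUnion_subset.2 hXsub)
  have hempty : ∀ v ∈ allies g i, ¬ ∀ j ∈ allies g i, v ∈ X j := fun v hv hall =>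
    hXj v hv (hall v hv)
  replace key : 2 * (X j₀).card ≤ ((allies g i).biUnion X).card := by
    rw [← zero_add ((allies g i).biUnion X).card, ← card_filter_eq_zero_iff.2 hempty]
    convert key
  have h1 : (2 : ℝ) * (X j₀).card ≤ (allies g i).card := by exact_mod_cast key.trans hunion
  have h2 := hXlt j₀ hj₀
  have h3 := hsd (X j₀) (hXsub j₀ hj₀)
  nlinarith [Nat.cast_nonneg (α := ℝ) (allies g i \ X j₀).card]

end Stable

/-! ### The empty network -/

theorem not_cnWarStable_bot {γ : ℝ} (hγ : γ < 2) {a b c : V} (hab : a ≠ b) (hca : c ≠ a)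
    (hcb : c ≠ b) : ¬ CNWarStable cardStrength (fun _ _ => γ) (⊥ : SimpleGraph V) := by
  intro h
  refine h.add_alliance a b hab (by simp) c ⟨a, {a, b}, by simp, by simp [hca, hcb], ?_, ?_⟩
  · rw [coe_pair, SimpleGraph.isClique_pair]
    intro _
    simp [addAlliance, SimpleGraph.edge_adj, hab]
  · have : allies (addAlliance ⊥ a b) c = ∅ := by
      ext v
      simp [mem_allies, addAlliance, SimpleGraph.edge_adj, hca, hcb]
    simp only [Wins, cardStrength, card_defenders, this, card_pair hab]
    simpa using hγ

theorem cnWarStable_bot {γ : ℝ} (hγ : 2 ≤ γ) :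
    CNWarStable cardStrength (fun _ _ => γ) (⊥ : SimpleGraph V) := by
  have key : ∀ (g : SimpleGraph V) (i : V),
      (∀ C : Finset V, g.IsClique (C : Set V) → C.card ≤ 2) →
      ¬ CNVulnerable cardStrength (fun _ _ => γ) g i := by
    rintro g i hg ⟨j, C, -, -, hC, hlt⟩
    simp only [Wins, cardStrength, card_defenders] at hlt
    have h1 : (C.card : ℝ) ≤ 2 := by exact_mod_cast hg C hC
    push_cast at hlt
    nlinarith [Nat.cast_nonneg (α := ℝ) (allies g i \ C).card]
  refine ⟨fun i => key _ i fun C hC => ?_, fun a b hab _ i => key _ i fun C hC => ?_, ?_⟩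
  · refine (card_le_one.2 fun u hu v hv => ?_).trans one_le_two
    by_contra huv
    exact hC hu hv huv
  · refine le_trans ?_ (card_le_two (a := a) (b := b))
    by_cases hC1 : C.card ≤ 1
    · exact hC1.trans (by rw [card_pair hab]; norm_num)
    · obtain ⟨u, hu, v, hv, huv⟩ := one_lt_card.1 (not_le.1 hC1)
      -- Each member of `C` has a neighbour in `C`, hence is an endpoint of the only edge `ab`.
      refine card_le_card fun x hx => ?_
      obtain ⟨y, hy, hxy⟩ : ∃ y ∈ C, x ≠ y := by
        by_cases hxu : x = u
        · exact ⟨v, hv, hxu ▸ huv⟩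
        · exact ⟨u, hu, hxu⟩
      have := hC hx hy hxy
      simp only [addAlliance, bot_sup_eq, SimpleGraph.edge_adj] at this
      simp only [mem_insert, mem_singleton]
      tauto
  · intro j k hjk
    exact absurd hjk (by simp)

/-! ### Reduction of nearly equal strengths to sizes -/

theorem CNWarStable.congr {M M' : Finset V → ℝ} {γ : ℝ}
    (hM : ∀ C D : Finset V, C.Nonempty → D.Nonempty → Disjoint C D →
      (Wins M (fun _ _ => γ) C D ↔ Wins M' (fun _ _ => γ) C D)) (g : SimpleGraph V) :
    CNWarStable M (fun _ _ => γ) g ↔ CNWarStable M' (fun _ _ => γ) g := by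
  have hv : ∀ g i, CNVulnerable M (fun _ _ => γ) g i ↔ CNVulnerable M' (fun _ _ => γ) g i := by
    intro g i
    unfold CNVulnerable
    refine exists_congr fun j => exists_congr fun C => and_congr_right fun hj =>
      and_congr_right fun hi => and_congr_right fun _ => hM C _ ⟨j, hj⟩ ?_ ?_
    · exact ⟨i, by simp [defenders_eq]⟩
    · rw [defenders_eq, disjoint_insert_right]
      exact ⟨hi, disjoint_sdiff⟩
  constructor
  · rintro ⟨h1, h2, h3⟩
    simp only [hv] at h1 h2 h3
    exact ⟨h1, h2, h3⟩
  · rintro ⟨h1, h2, h3⟩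
    simp only [← hv] at h1 h2 h3
    exact ⟨h1, h2, h3⟩

open Filter Topology in
/-- Without ties, small perturbations of the common strength do not change the outcome of any
war between disjoint nonempty coalitions. -/
theorem NoTie.exists_pos {γ : ℝ} {n : ℕ} (hγ : NoTie γ n) (x : ℝ) (hx : 0 < x) :
    ∃ ε : ℝ, 0 < ε ∧ ε < x ∧ ∀ a b : ℕ, 0 < a → 0 < b → a + b ≤ n →
      (γ * b < a ∧ γ * (b * (x + ε)) < a * (x - ε)) ∨
      (a < γ * b ∧ a * (x + ε) < γ * (b * (x - ε))) := by
  have hpair : ∀ a b : ℕ, ∀ᶠ ε in 𝓝 (0 : ℝ), 0 < a → 0 < b → a + b ≤ n →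
      (γ * b < a ∧ γ * (b * (x + ε)) < a * (x - ε)) ∨
      (a < γ * b ∧ a * (x + ε) < γ * (b * (x - ε))) := by
    intro a b
    by_cases hab : 0 < a ∧ 0 < b ∧ a + b ≤ n
    · obtain ⟨ha, hb, hn⟩ := hab
      -- Strict inequalities at `ε = 0` persist nearby by continuity; the tie is excluded. Only
      -- finitely many pairs of sizes occur, so one `ε` serves all.
      rcases lt_trichotomy (a : ℝ) (γ * b) with hlt | heq | hlt
      · have h1 : ∀ᶠ ε in 𝓝 (0 : ℝ), a * (x + ε) < γ * (b * (x - ε)) := by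
          refine ContinuousAt.eventually_lt (by fun_prop) (by fun_prop) ?_
          nlinarith
        filter_upwards [h1] with ε hε _ _ _ using Or.inr ⟨hlt, hε⟩
      · exact absurd ⟨a, b, ha, hb, hn, heq⟩ hγ
      · have h1 : ∀ᶠ ε in 𝓝 (0 : ℝ), γ * (b * (x + ε)) < a * (x - ε) := by
          refine ContinuousAt.eventually_lt (by fun_prop) (by fun_prop) ?_
          nlinarith
        filter_upwards [h1] with ε hε _ _ _ using Or.inl ⟨hlt, hε⟩
    · exact Eventually.of_forall fun ε h1 h2 h3 => absurd ⟨h1, h2, h3⟩ hab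
  have hall : ∀ᶠ ε in 𝓝 (0 : ℝ), ∀ a ∈ range (n + 1), ∀ b ∈ range (n + 1),
      0 < a → 0 < b → a + b ≤ n →
      (γ * b < a ∧ γ * (b * (x + ε)) < a * (x - ε)) ∨
      (a < γ * b ∧ a * (x + ε) < γ * (b * (x - ε))) := by
    simp only [eventually_all_finset]
    exact fun a _ b _ => hpair a b
  have hpos : ∀ᶠ ε in 𝓝[>] (0 : ℝ), 0 < ε := eventually_mem_nhdsWithin
  have hsmall : ∀ᶠ ε in 𝓝 (0 : ℝ), ε < x := eventually_lt_nhds hx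
  obtain ⟨ε, ⟨hε, hεx⟩, h⟩ :=
    ((hpos.and (hsmall.filter_mono nhdsWithin_le_nhds)).and
      (hall.filter_mono nhdsWithin_le_nhds)).exists
  exact ⟨ε, hε, hεx, fun a b ha hb hn =>
    h a (mem_range.2 (by omega)) b (mem_range.2 (by omega)) ha hb hn⟩

theorem additiveStrength_bounds {V : Type*} {m : V → ℝ} {l u : ℝ} (hm : ∀ i, m i ∈ Set.Ioo l u)
    (C : Finset V) :
    C.card * l ≤ additiveStrength m C ∧ additiveStrength m C ≤ C.card * u := by
  rw [← nsmul_eq_mul, ← nsmul_eq_mul]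
  exact ⟨card_nsmul_le_sum _ _ _ fun i _ => (hm i).1.le,
    sum_le_card_nsmul _ _ _ fun i _ => (hm i).2.le⟩

end WarNetwork

/-! ### Transfer to additive strengths -/

theorem mainTheorem5 (n : ℕ) (hn : 3 ≤ n) (γ : ℝ) (hγ : WarNetwork.NoTie γ n)
    (Mbar : ℝ) (hMbar : 0 < Mbar) :
    ∃ S : Set ℝ, IsOpen S ∧ Mbar ∈ S ∧ S ⊆ Set.Ioi 0 ∧
      (1 ≤ γ → γ < 2 → ∀ m : Fin n → ℝ, (∀ i, m i ∈ S) →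
        ¬ ∃ g : SimpleGraph (Fin n),
          WarNetwork.CNWarStable (WarNetwork.additiveStrength m) (fun _ _ => γ) g) ∧
      (2 ≤ γ → ∀ m : Fin n → ℝ, (∀ i, m i ∈ S) →
        ∀ g : SimpleGraph (Fin n),
          WarNetwork.CNWarStable (WarNetwork.additiveStrength m) (fun _ _ => γ) g ↔ g = ⊥) := by
  obtain ⟨ε, hε, hεM, hpert⟩ := hγ.exists_pos Mbar hMbar
  have hred : 1 ≤ γ → ∀ m : Fin n → ℝ, (∀ i, m i ∈ Set.Ioo (Mbar - ε) (Mbar + ε)) →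
      ∀ g : SimpleGraph (Fin n),
        WarNetwork.CNWarStable (WarNetwork.additiveStrength m) (fun _ _ => γ) g ↔
          WarNetwork.CNWarStable WarNetwork.cardStrength (fun _ _ => γ) g := by
    intro hγ1 m hm
    refine WarNetwork.CNWarStable.congr fun C D hC hD hCD => ?_
    have hsum : C.card + D.card ≤ n := by
      rw [← Finset.card_union_of_disjoint hCD]
      simpa using Finset.card_le_univ (C ∪ D)
    obtain ⟨hC1, hC2⟩ := WarNetwork.additiveStrength_bounds hm C
    obtain ⟨hD1, hD2⟩ := WarNetwork.additiveStrength_bounds hm D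
    have hγ0 : 0 ≤ γ := by linarith
    have hD1' := mul_le_mul_of_nonneg_left hD1 hγ0
    have hD2' := mul_le_mul_of_nonneg_left hD2 hγ0
    simp only [WarNetwork.Wins, WarNetwork.cardStrength]
    rcases hpert C.card D.card hC.card_pos hD.card_pos hsum with ⟨h1, h2⟩ | ⟨h1, h2⟩
    · exact iff_of_true (by linarith) h1
    · exact iff_of_false (by linarith) (by linarith)
  refine ⟨Set.Ioo (Mbar - ε) (Mbar + ε), isOpen_Ioo, ⟨by linarith, by linarith⟩,
    fun x hx => ?_, ?_, ?_⟩
  · have := hx.1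
    exact Set.mem_Ioi.2 (by linarith)
  · rintro hγ1 hγ2 m hm ⟨g, hg⟩
    rw [hred hγ1 m hm] at hg
    obtain rfl := hg.eq_bot hγ1
    exact WarNetwork.not_cnWarStable_bot hγ2 (a := (⟨0, by omega⟩ : Fin n))
      (b := ⟨1, by omega⟩) (c := ⟨2, by omega⟩) (by simp [Fin.ext_iff]) (by simp [Fin.ext_iff])
      (by simp [Fin.ext_iff]) hg
  · intro hγ2 m hm g
    rw [hred (by linarith) m hm]
    refine ⟨fun h => h.eq_bot (by linarith), ?_⟩
    rintro rfl
    exact WarNetwork.cnWarStable_bot hγ2
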